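/- **Setting.** Fix an integer $T\ge 1$. For $t=0,\dots,T-1$ let $A_t\in\mathbb R^{n\times n}$, $B_t\in\mathbb R^{n\times m}$, $\varphi_t\in\mathbb R^n$, let $\mathcal U_t\subset\mathbb R^m$ be closed and convex, and let $\ell_t,f_t:\mathbb R^n\times\mathbb R^m\to\mathbb R$ be convex; for $t=0,\dots,T$ let $\mathcal X_t\subset\mathbb R^n$ be closed and convex; let $g:\mathbb R^n\to\mathbb R\cup\{+\infty\}$ be proper, convex and lower semicontinuous (lsc). Write $\operatorname{dom} g=\{g<+\infty\}$, $\operatorname{ri}$ for the relative interior, $\delta_S$ for the indicator function of $S$ ($0$ on $S$, $+\infty$ off $S$), $\Delta x_{t}=x_{t}-x_{t-1}$, and $\Omega_t=\{(x,u): x\in\mathcal X_t,\ u\in\mathcal U_t,\ f_t(x,u)\le 0\}$. Assume $\Omega_t\neq\emptyset$ for $0\le t\le T-1$ and $\mathcal X_T\cap\operatorname{dom} g\ne\emptyset$. For $0\le\tau\le T-1$ and $\xi\in\mathbb R^n$ consider the problem $$(\mathrm P_{\rm mix})\quad \inf\Big\{\sum_{t=\tau}^{T-1}\ell_t(x_t,u_t)+g(x_T)\Big\}$$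 over all $x_\tau,\dots,x_T\in\mathbb R^n$ and $u_\tau,\dots,u_{T-1}\in\mathbb R^m$ with $x_\tau=\xi$, $\Delta x_{t+1}=A_tx_t+B_tu_t+\varphi_t$, $f_t(x_t,u_t)\le0$, $u_t\in\mathcal U_t$ for $\tau\le t\le T-1$, and $x_t\in\mathcal X_t$ for $\tau\le t\le T$. For $t=0,\dots,T-1$ put $$L_{t+1}(x,v)=\inf\{\ell_t(x,u): (x,u)\in\Omega_t,\ v=A_tx+B_tu+\varphi_t\},\qquad \tilde g=g+\delta_{\mathcal X_T},$$ $$\vartheta_\tau(\xi)=\inf\Big\{\sum_{t=\tau+1}^{T}L_t(x_{t-1},\Delta x_t)+\tilde g(x_T): x_\tau=\xi\Big\},\qquad H_t(x,p)=\sup_{v}\{p\cdot v-L_t(x,v)\}.$$ For $\phi:\mathbb R^n\to\mathbb R\cup\{\pm\infty\}$ and $x\in\operatorname{dom}\phi$ let $\partial\phi(x)=\{y:\phi(x)+y\cdot(z-x)\le\phi(z)\ \forall z\}$, with $\partial\phi(x)=\emptyset$ for $x\notin\operatorname{dom}\phi$; and let $\partial H_t(x,p)=[-\partial(-H_t(\cdot,p))(x)]\times\partial(H_t(x,\cdot))(p)$.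 We say that a *characteristic* joins $(\tau,\xi,\eta)$ if there are $x_\tau,\dots,x_T$ and $p_\tau,\dots,p_T$ in $\mathbb R^n$ with $(x_\tau,p_\tau)=(\xi,-\eta)$, $(-\Delta p_t,\Delta x_t)\in\partial H_t(x_{t-1},p_t)$ for $\tau+1\le t\le T$, and $-p_T\in\partial\tilde g(x_T)$. **Proposition.** Assume (A) for each $0\le t\le T-1$ there is an upper semicontinuous $\psi_t:\mathbb R^n\to\mathbb R$ such that $\sup\{|u|:u\in\mathcal U_t,\ f_t(x,u)\le0\}\le\psi_t(x)$ for all $x\in\mathcal X_t$. Then: 1. $L_1,\dots,L_T$ and $\tilde g$ are proper, convex and lsc, and the value of $(\mathrm P_{\rm mix})$ equals $\vartheta_\tau(\xi)$ for all $0\le\tau\le T-1$ and $\xi\in\mathbb R^n$. 2. For all $0\le\tau\le T-1$ and $\xi,\eta\in\mathbb R^n$: if a characteristic joins $(\tau,\xi,\eta)$, then $\eta\in\partial\vartheta_\tau(\xi)$. 3. Let $0\le\tau\le T-1$. Suppose that there are $x_\tau,\dots,x_T\in\mathbb R^n$ and $u_\tau,\dots,u_{T-1}\in\mathbb R^m$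 with $(A_t+I_n)x_t-x_{t+1}+B_tu_t=-\varphi_t$, $x_t\in\operatorname{ri}\mathcal X_t$, $u_t\in\operatorname{ri}\mathcal U_t$ and $f_t(x_t,u_t)<0$ for $\tau\le t\le T-1$, and $x_T\in\operatorname{ri}(\mathcal X_T\cap\operatorname{dom} g)$. Suppose moreover that one of the following holds: (a) for every $\tau\le t\le T-1$: $\mathcal U_t$ is compact and $A_t^T+I_n$ has rank $n$; or $\mathcal X_t$ is compact; or $f_t$ is coercive in $x$ (for each $u$, $f_t(x,u)\to+\infty$ as $|x|\to\infty$); (b) for every $\tau\le t\le T-1$: $\ell_t$ is coercive ($\ell_t(x,u)\to+\infty$ as $|(x,u)|\to\infty$); or $A_t^T+I_n$ has rank $n$ and there are $\kappa_0\in\mathbb R$ and $h_t:\mathbb R^m\to\mathbb R$ such that $\sup\{|x|:(x,u)\in\Omega_t,\ \ell_t(x,u)-\langle z,u\rangle\le\kappa_0\}\le h_t(z)$ for all $z\in\mathbb R^m$. Then the converse of 2 holds at $\tau$: for all $\xi,\eta\in\mathbb R^n$, if $\eta\in\partial\vartheta_\tau(\xi)$, then a characteristic joins $(\tau,\xi,\eta)$.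 -/

import Mathlib

open Set Filter

noncomputable section

namespace BolzaMix

/-! ### Extended-real convex analysis -/

section ConvexAnalysis

variable {E : Type*}

/-- The effective domain of an extended-real-valued function. -/
def dom (φ : E → EReal) : Set E := {x | φ x < ⊤}

/-- Proper: not identically `+∞` and never `-∞`. -/
def IsProper (φ : E → EReal) : Prop := (dom φ).Nonempty ∧ ∀ x, ⊥ < φ x

/-- Convexity through the (real) epigraph. -/
def IsConvexFun [AddCommGroup E] [Module ℝ E] (φ : E → EReal) : Prop :=
  Convex ℝ {q : E × ℝ | φ q.1 ≤ (q.2 : EReal)}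

/-- Proper, convex and lower semicontinuous. -/
structure IsProperConvexLsc [AddCommGroup E] [Module ℝ E] [TopologicalSpace E]
    (φ : E → EReal) : Prop where
  proper : IsProper φ
  convex : IsConvexFun φ
  lsc : LowerSemicontinuous φ

open Classical in
/-- The indicator function `δ_S`, equal to `0` on `S` and to `+∞` off `S`. -/
def indic (S : Set E) (x : E) : EReal := if x ∈ S then 0 else ⊤

variable [NormedAddCommGroup E] [InnerProductSpace ℝ E]

/-- The subdifferential of `φ` at `x`; it is empty when `x ∉ dom φ`. -/
def subdiff (φ : E → EReal) (x : E) : Set E :=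
  {y | x ∈ dom φ ∧ ∀ z, φ x + ((inner ℝ y (z - x) : ℝ) : EReal) ≤ φ z}

/-- The concave-convex subdifferential `[-∂(-h(·,y))(x)] × ∂(h(x,·))(y)`. -/
def saddleSubdiff (h : E → E → EReal) (x y : E) : Set (E × E) :=
  {q | -q.1 ∈ subdiff (fun x' => -h x' y) x ∧ q.2 ∈ subdiff (h x) y}

/-! ### The discrete-time Bolza problem

The Lagrangians `L 1, …, L T` are the relevant ones; arcs are functions on `ℕ` of which only the
values at `τ, …, T` are used. -/

/-- The value function
`ϑ_τ(ξ) = inf { ∑_{t=τ+1}^T L_t(x_{t-1}, Δx_t) + g(x_T) : x_τ = ξ }`. -/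
def bolzaValue (T : ℕ) (L : ℕ → E → E → EReal) (g : E → EReal) (τ : ℕ) (ξ : E) : EReal :=
  ⨅ (x : ℕ → E) (_ : x τ = ξ),
    (∑ t ∈ Finset.Ico τ T, L (t + 1) (x t) (x (t + 1) - x t)) + g (x T)

/-- The Hamiltonian `H(t,x,p) = sup_v { p·v - L_t(x,v) }`. -/
def hamiltonian (L : ℕ → E → E → EReal) (t : ℕ) (x p : E) : EReal :=
  ⨆ v : E, ((inner ℝ p v : ℝ) : EReal) - L t x v

/-- Discrete-time Hamiltonian trajectories on `{τ, …, T}`: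
`(-Δp_t, Δx_t) ∈ ∂H_t(x_{t-1}, p_t)` for `t = τ+1, …, T`. -/
def IsHamiltonianTrajectory (T : ℕ) (L : ℕ → E → E → EReal) (τ : ℕ) (x p : ℕ → E) : Prop :=
  ∀ t ∈ Finset.Ico τ T,
    (-(p (t + 1) - p t), x (t + 1) - x t) ∈
      saddleSubdiff (hamiltonian L (t + 1)) (x t) (p (t + 1))

/-- There is a Hamiltonian trajectory on `{τ, …, T}` starting at `(ξ, -η)` that satisfies the
transversality condition `-p_T ∈ ∂g(x_T)`. -/
def HasCharacteristic (T : ℕ) (L : ℕ → E → E → EReal) (g : E → EReal) (τ : ℕ) (ξ η : E) : Prop :=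
  ∃ x p : ℕ → E, IsHamiltonianTrajectory T L τ x p ∧ x τ = ξ ∧ p τ = -η ∧
    -p T ∈ subdiff g (x T)

end ConvexAnalysis

/-! ### The linear-convex problem with mixed constraints -/

/-- The data of the problem: horizon, matrices, drifts, state and control constraint sets, running
costs, mixed-constraint functions and terminal cost. `A`, `B`, `drift`, `U`, `ℓ`, `f` are used at
times `0, …, T-1` and `X` at times `0, …, T`. -/
structure MixProblem (n m : ℕ) where
  T : ℕ
  A : ℕ → Matrix (Fin n) (Fin n) ℝ
  B : ℕ → Matrix (Fin n) (Fin m) ℝ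
  drift : ℕ → EuclideanSpace ℝ (Fin n)
  X : ℕ → Set (EuclideanSpace ℝ (Fin n))
  U : ℕ → Set (EuclideanSpace ℝ (Fin m))
  ℓ : ℕ → EuclideanSpace ℝ (Fin n) → EuclideanSpace ℝ (Fin m) → ℝ
  f : ℕ → EuclideanSpace ℝ (Fin n) → EuclideanSpace ℝ (Fin m) → ℝ
  g : EuclideanSpace ℝ (Fin n) → EReal

namespace MixProblem

variable {n m : ℕ} (P : MixProblem n m)

/-- The velocity `A_t x + B_t u + φ_t`. -/
def velocity (t : ℕ) (x : EuclideanSpace ℝ (Fin n)) (u : EuclideanSpace ℝ (Fin m)) :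
    EuclideanSpace ℝ (Fin n) :=
  Matrix.toEuclideanLin (P.A t) x + Matrix.toEuclideanLin (P.B t) u + P.drift t

/-- `Ω_t = {(x,u) : x ∈ X_t, u ∈ U_t, f_t(x,u) ≤ 0}`. -/
def Omega (t : ℕ) : Set (EuclideanSpace ℝ (Fin n) × EuclideanSpace ℝ (Fin m)) :=
  {q | q.1 ∈ P.X t ∧ q.2 ∈ P.U t ∧ P.f t q.1 q.2 ≤ 0}

/-- Feasible processes of the optimal control problem with initial data `(τ, ξ)`. -/
structure IsFeasible (τ : ℕ) (ξ : EuclideanSpace ℝ (Fin n))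
    (x : ℕ → EuclideanSpace ℝ (Fin n)) (u : ℕ → EuclideanSpace ℝ (Fin m)) : Prop where
  init : x τ = ξ
  dyn : ∀ t ∈ Finset.Ico τ P.T, x (t + 1) - x t = P.velocity t (x t) (u t)
  mixed : ∀ t ∈ Finset.Ico τ P.T, P.f t (x t) (u t) ≤ 0
  control : ∀ t ∈ Finset.Ico τ P.T, u t ∈ P.U t
  state : ∀ t ∈ Finset.Icc τ P.T, x t ∈ P.X t

/-- The optimal value of the control problem with initial data `(τ, ξ)`. -/
def value (τ : ℕ) (ξ : EuclideanSpace ℝ (Fin n)) : EReal :=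
  ⨅ (x : ℕ → EuclideanSpace ℝ (Fin n)) (u : ℕ → EuclideanSpace ℝ (Fin m))
    (_ : P.IsFeasible τ ξ x u),
    ((∑ t ∈ Finset.Ico τ P.T, P.ℓ t (x t) (u t) : ℝ) : EReal) + P.g (x P.T)

/-- The Lagrangians `L_1, …, L_T`; with `t = s - 1`,
`L_s(x,v) = inf_u { ℓ_t(x,u) + δ_{U_t}(u) + δ_{D_t}(x,u) + δ_{S_t}(x,u,v) + δ_{X_t}(x) }`, where
`D_t = {f_t ≤ 0}` and `S_t = {v = A_t x + B_t u + φ_t}`. No summand is `-∞`. -/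
def lagrangian (s : ℕ) (x v : EuclideanSpace ℝ (Fin n)) : EReal :=
  ⨅ u : EuclideanSpace ℝ (Fin m),
    (P.ℓ (s - 1) x u : EReal) + indic (P.U (s - 1)) u
      + indic {q : EuclideanSpace ℝ (Fin n) × EuclideanSpace ℝ (Fin m) |
          P.f (s - 1) q.1 q.2 ≤ 0} (x, u)
      + indic {q : EuclideanSpace ℝ (Fin n) × EuclideanSpace ℝ (Fin m) ×
          EuclideanSpace ℝ (Fin n) | q.2.2 = P.velocity (s - 1) q.1 q.2.1} (x, u, v)
      + indic (P.X (s - 1)) x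

/-- The terminal cost `g + δ_{X_T}`, which carries the constraint `x_T ∈ X_T`. -/
def terminalCost (x : EuclideanSpace ℝ (Fin n)) : EReal := P.g x + indic (P.X P.T) x

/-- The standing assumptions on the data. -/
structure IsLinearConvex : Prop where
  X_closed : ∀ t ≤ P.T, IsClosed (P.X t)
  X_convex : ∀ t ≤ P.T, Convex ℝ (P.X t)
  U_closed : ∀ t < P.T, IsClosed (P.U t)
  U_convex : ∀ t < P.T, Convex ℝ (P.U t)
  ℓ_convex : ∀ t < P.T, ConvexOn ℝ univ
    (fun q : EuclideanSpace ℝ (Fin n) × EuclideanSpace ℝ (Fin m) => P.ℓ t q.1 q.2)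
  f_convex : ∀ t < P.T, ConvexOn ℝ univ
    (fun q : EuclideanSpace ℝ (Fin n) × EuclideanSpace ℝ (Fin m) => P.f t q.1 q.2)
  g_pcl : IsProperConvexLsc P.g

/-- Condition (A) at time `t`: an upper semicontinuous `ψ : ℝⁿ → ℝ` with
`sup {|u| : u ∈ U_t, f_t(x,u) ≤ 0} ≤ ψ(x)` for all `x ∈ X_t`. -/
def CondA (t : ℕ) : Prop :=
  ∃ ψ : EuclideanSpace ℝ (Fin n) → ℝ, UpperSemicontinuous ψ ∧
    ∀ x ∈ P.X t, ∀ u ∈ P.U t, P.f t x u ≤ 0 → ‖u‖ ≤ ψ x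

/-- Condition (B) at time `t`: there are `κ₀ ∈ ℝ` and `h : ℝᵐ → ℝ` with
`sup {|x| : (x,u) ∈ Ω_t, ℓ_t(x,u) - ⟨z,u⟩ ≤ κ₀} ≤ h(z)` for all `z`. -/
def CondB (t : ℕ) : Prop :=
  ∃ (κ₀ : ℝ) (h : EuclideanSpace ℝ (Fin m) → ℝ), ∀ z x u, (x, u) ∈ P.Omega t →
    P.ℓ t x u - inner ℝ z u ≤ κ₀ → ‖x‖ ≤ h z

/-- The matrix `A_tᵀ + I_n` has rank `n`. -/
def RankCond (t : ℕ) : Prop := ((P.A t).transpose + 1).rank = n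

/-- `f_t` is coercive in `x`: `f_t(x,u) → +∞` as `|x| → ∞`, for each `u`. -/
def CoerciveInState (t : ℕ) : Prop :=
  ∀ u, Tendsto (fun x => P.f t x u) (cocompact (EuclideanSpace ℝ (Fin n))) atTop

/-- `ℓ_t` is coercive: `ℓ_t(x,u) → +∞` as `|(x,u)| → ∞`. -/
def CoerciveCost (t : ℕ) : Prop :=
  Tendsto (fun q : EuclideanSpace ℝ (Fin n) × EuclideanSpace ℝ (Fin m) => P.ℓ t q.1 q.2)
    (cocompact (EuclideanSpace ℝ (Fin n) × EuclideanSpace ℝ (Fin m))) atTop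

/-- A solution on `{τ, …, T}` of the linear system
`(A_t + I_n) x_t - x_{t+1} + B_t u_t = -φ_t` that lies in the relative interiors of the constraint
sets and satisfies the mixed constraints strictly. -/
def HasSlaterSolution (τ : ℕ) : Prop :=
  ∃ (x : ℕ → EuclideanSpace ℝ (Fin n)) (u : ℕ → EuclideanSpace ℝ (Fin m)),
    (∀ t ∈ Finset.Ico τ P.T,
      Matrix.toEuclideanLin (P.A t + 1) (x t) - x (t + 1) + Matrix.toEuclideanLin (P.B t) (u t)
          = -P.drift t ∧
        x t ∈ intrinsicInterior ℝ (P.X t) ∧ u t ∈ intrinsicInterior ℝ (P.U t) ∧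
        P.f t (x t) (u t) < 0) ∧
    x P.T ∈ intrinsicInterior ℝ (P.X P.T ∩ dom P.g)

end MixProblem

end BolzaMix

end

noncomputable section

namespace BolzaMix

open scoped Topology

/-! ### Relative cores and linear multipliers -/

/-! Dynamic programming reduces everything to the one-step problem ϑ_τ(ξ) = min_y { L_{τ+1}(ξ, y -
ξ) + ϑ_{τ+1}(y) }. Condition (A) bounds the admissible controls, hence the velocities, locally in
the state, so the infima over controls and over next states are effectively over compact sets. They
are attained, and they preserve convexity, lower semicontinuity and the exclusion of -∞
(`IsLinearConvex.isRegularLagrangian`, `IsRegularValue.step`).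

By Fenchel duality in the velocity, a Hamiltonian inclusion with new costate p and old costate -η
says exactly that (p + η, p) is a subgradient of L at (x, v) (`mem_saddleSubdiff_hamiltonian_iff`).
Adding the inequality for -p ∈ ∂ϑ_{τ+1} cancels p and leaves η ∈ ∂ϑ_τ(ξ); this is sufficiency.

Conversely, η ∈ ∂ϑ_τ(ξ) makes an optimal step minimize L(x, w) + ϑ_{τ+1}(y) - η·x under the linear
constraint y = x + w, and p is the multiplier of that constraint (`exists_multiplier`). It exists
because the Slater process supplies relative-core points of both domains that satisfy the
constraint. Relative cores pass through affine images and projections, hence from the constraint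
sets to the domains of the Lagrangians and value functions (`mem_relCore_dom_bolzaValue`). -/

/-- The algebraic relative interior: points of `C` from which every segment ending in `C` can be
prolonged a little in the opposite direction. -/
def relCore {V : Type*} [AddCommGroup V] [Module ℝ V] (C : Set V) : Set V :=
  {x | x ∈ C ∧ ∀ z ∈ C, ∀ᶠ δ : ℝ in 𝓝[>] 0, x + δ • (x - z) ∈ C}

/-- The whole line through x and z lies in the affine span, where C is a neighbourhood of x. -/
theorem intrinsicInterior_subset_relCore {V : Type*} [NormedAddCommGroup V] [NormedSpace ℝ V]
    (C : Set V) : intrinsicInterior ℝ C ⊆ relCore C := by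
  intro x hx
  refine ⟨intrinsicInterior_subset hx, fun z hz => ?_⟩
  obtain ⟨y, hy, rfl⟩ := mem_intrinsicInterior.1 hx
  have hzs : z ∈ affineSpan ℝ C := subset_affineSpan ℝ C hz
  have hmem : ∀ δ : ℝ, (y : V) + δ • ((y : V) - z) ∈ affineSpan ℝ C := fun δ => by
    have h := (affineSpan ℝ C).smul_vsub_vadd_mem δ y.2 hzs y.2
    rwa [vsub_eq_sub, vadd_eq_add, add_comm] at h
  let F : ℝ → affineSpan ℝ C := fun δ => ⟨(y : V) + δ • ((y : V) - z), hmem δ⟩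
  have hF : Continuous F := Continuous.subtype_mk (by fun_prop) _
  have hF0 : F 0 = y := Subtype.ext (by simp [F])
  have h : ∀ᶠ δ in 𝓝 (0 : ℝ), F δ ∈ ((↑) ⁻¹' C : Set (affineSpan ℝ C)) :=
    hF.continuousAt.eventually_mem (by rw [hF0]; exact mem_interior_iff_mem_nhds.1 hy)
  exact nhdsWithin_le_nhds h

/-- A convex set `G` in `V × ℝ` whose fibre over `0` is bounded below by `r₀` has a non-vertical
affine support at `(0, r₀)` when every direction of its projection can be reversed. -/
theorem exists_linearMap_le_of_convex {V : Type*} [AddCommGroup V] [Module ℝ V]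
    {G : Set (V × ℝ)} (hG : Convex ℝ G) {r₀ : ℝ} (h0 : (0, r₀) ∈ G)
    (hle : ∀ r, ((0 : V), r) ∈ G → r₀ ≤ r)
    (hrev : ∀ q ∈ G, ∃ ε : ℝ, 0 < ε ∧ ∃ r, (-(ε • q.1), r) ∈ G) :
    ∃ f : V →ₗ[ℝ] ℝ, ∀ q ∈ G, r₀ + f q.1 ≤ q.2 := by
  -- The weights t₂/(t₁+t₂) and t₁/(t₁+t₂) equalize the two scalings, so that a multiple of w₁ + w₂
  -- appears.
  have comb : ∀ {w₁ w₂ : V} {r₁ r₂ t₁ t₂ : ℝ}, 0 < t₁ → 0 < t₂ → (t₁ • w₁, r₁) ∈ G →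
      (t₂ • w₂, r₂) ∈ G → ((t₁ * t₂ / (t₁ + t₂)) • (w₁ + w₂),
        (t₂ * r₁ + t₁ * r₂) / (t₁ + t₂)) ∈ G := by
    intro w₁ w₂ r₁ r₂ t₁ t₂ ht₁ ht₂ h₁ h₂
    have h := hG h₁ h₂ (a := t₂ / (t₁ + t₂)) (b := t₁ / (t₁ + t₂)) (by positivity)
      (by positivity) (by field_simp; ring)
    convert h using 1
    ext1
    · simp only [Prod.fst_add, Prod.smul_fst, smul_smul, smul_add]
      congr 2 <;> field_simp
    · simp only [Prod.snd_add, Prod.smul_snd, smul_eq_mul]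
      field_simp
  -- The cone over the projection of G; reversibility of directions makes it a subspace.
  let W : Submodule ℝ V :=
    { carrier := {w | ∃ t : ℝ, 0 < t ∧ ∃ r, (t • w, r) ∈ G}
      zero_mem' := ⟨1, one_pos, r₀, by simpa using h0⟩
      add_mem' := by
        rintro w₁ w₂ ⟨t₁, ht₁, r₁, h₁⟩ ⟨t₂, ht₂, r₂, h₂⟩
        exact ⟨_, by positivity, _, comb ht₁ ht₂ h₁ h₂⟩
      smul_mem' := by
        rintro c w ⟨t, ht, r, h⟩
        rcases lt_trichotomy c 0 with hc | rfl | hc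
        · obtain ⟨ε, hε, r', h'⟩ := hrev _ h
          refine ⟨ε * t / (-c), div_pos (by positivity) (by linarith), r', ?_⟩
          convert h' using 2
          rw [smul_smul, smul_smul, ← neg_smul]
          congr 1
          have := hc.ne
          field_simp
        · exact ⟨1, one_pos, r₀, by simpa using h0⟩
        · refine ⟨t / c, by positivity, r, ?_⟩
          rwa [smul_smul, div_mul_cancel₀ _ hc.ne'] }
  -- The convex cone generated by G - (0, r₀), viewed inside W × ℝ.
  let s : PointedCone ℝ (W × ℝ) :=
    { carrier := {q | ∃ t : ℝ, 0 < t ∧ (t • (q.1 : V), r₀ + t * q.2) ∈ G}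
      zero_mem' := ⟨1, one_pos, by simpa using h0⟩
      add_mem' := by
        rintro q₁ q₂ ⟨t₁, ht₁, h₁⟩ ⟨t₂, ht₂, h₂⟩
        refine ⟨t₁ * t₂ / (t₁ + t₂), by positivity, ?_⟩
        convert comb ht₁ ht₂ h₁ h₂ using 2
        · rfl
        rw [Prod.snd_add]
        field_simp
        ring
      smul_mem' := by
        rintro ⟨c, hc⟩ q ⟨t, ht, h⟩
        rcases hc.eq_or_lt with rfl | hc
        · exact ⟨1, one_pos, by simpa using h0⟩
        · refine ⟨t / c, by positivity, ?_⟩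
          convert h using 2
          · change (t / c) • (c • (q.1 : V)) = _
            rw [smul_smul, div_mul_cancel₀ _ hc.ne']
          · change _ + t / c * (c * q.2) = _
            field_simp }
  let D : Submodule ℝ (W × ℝ) := (⊥ : Submodule ℝ W).prod ⊤
  -- The height is nonnegative on the part of s in the vertical axis, by the lower bound r₀, and any
  -- point of W × ℝ enters s after a vertical shift. The extension satisfies F(0, r) = r, so the
  -- support is not vertical.
  obtain ⟨F, hF, hFs⟩ := riesz_extension s ⟨D, (LinearMap.snd ℝ W ℝ).comp D.subtype⟩
    (by
      rintro ⟨⟨w, r⟩, hw, hr⟩ ⟨t, ht, h⟩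
      change 0 ≤ r
      have hw' : w = 0 := hw
      have := hle (r₀ + t * r) (by simpa [hw'] using h)
      nlinarith)
    (by
      rintro ⟨⟨w, t, ht, r₁, h⟩, r⟩
      refine ⟨⟨(0, (r₁ - r₀) / t - r), by simp [D]⟩, t, ht, ?_⟩
      simp only [Prod.fst_add, Prod.snd_add, zero_add]
      convert h using 2
      field_simp
      ring)
  -- A linear projection onto W extends the functional to all of V.
  obtain ⟨π, hπ⟩ := W.subtype.exists_leftInverse_of_injective W.ker_subtype
  refine ⟨-(F.comp ((LinearMap.inl ℝ W ℝ).comp π)), fun q hq => ?_⟩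
  have hqW : q.1 ∈ W := ⟨1, one_pos, q.2, by simpa using hq⟩
  have hπq : π q.1 = ⟨q.1, hqW⟩ := LinearMap.congr_fun hπ ⟨q.1, hqW⟩
  have h1 : 0 ≤ F (⟨q.1, hqW⟩, q.2 - r₀) := hFs _ ⟨1, one_pos, by simpa using hq⟩
  have h2 : F (0, q.2 - r₀) = q.2 - r₀ := hF ⟨(0, q.2 - r₀), by simp [D]⟩
  have h3 : F (⟨q.1, hqW⟩, q.2 - r₀) = F (⟨q.1, hqW⟩, 0) + F (0, q.2 - r₀) := by
    rw [← map_add]; simp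
  simp only [LinearMap.neg_apply, LinearMap.comp_apply, LinearMap.inl_apply, hπq]
  linarith

/-! ### Partial minimization and restriction of lower semicontinuous functions -/

/-- Near x₀ only y ∈ K matter, and by compactness a strict lower bound on {x₀} × K holds uniformly
for nearby x. -/
theorem lowerSemicontinuous_iInf_of_locally_compact {X Y : Type*} [TopologicalSpace X]
    [TopologicalSpace Y] {Φ : X × Y → EReal} (hΦ : LowerSemicontinuous Φ)
    (hK : ∀ x₀, ∃ K : Set Y, IsCompact K ∧ ∀ᶠ x in 𝓝 x₀, ∀ y ∉ K, Φ (x, y) = ⊤) :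
    LowerSemicontinuous fun x => ⨅ y, Φ (x, y) := by
  intro x₀ c hc
  obtain ⟨d, hcd, hd⟩ := exists_between hc
  obtain ⟨K, hKc, hKx⟩ := hK x₀
  have h := hKc.eventually_forall_of_forall_eventually (x₀ := x₀)
    (P := fun x y => d < Φ (x, y)) fun y _ => hΦ (x₀, y) d (hd.trans_le (iInf_le _ y))
  filter_upwards [h, hKx] with x hx1 hx2
  refine hcd.trans_le (le_iInf fun y => ?_)
  by_cases hy : y ∈ K
  · exact (hx1 y hy).le
  · rw [hx2 y hy]; exact le_top

theorem exists_eq_iInf_of_compact {Y : Type*} [TopologicalSpace Y] [Nonempty Y] {Φ : Y → EReal}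
    (hΦ : LowerSemicontinuous Φ) {K : Set Y} (hK : IsCompact K) (h : ∀ y ∉ K, Φ y = ⊤) :
    ∃ y, Φ y = ⨅ y, Φ y := by
  by_cases hne : K.Nonempty
  · obtain ⟨y, -, hy⟩ := LowerSemicontinuousOn.exists_isMinOn hne hK (hΦ.lowerSemicontinuousOn K)
    refine ⟨y, le_antisymm (le_iInf fun z => ?_) (iInf_le _ y)⟩
    by_cases hz : z ∈ K
    · exact hy hz
    · rw [h z hz]; exact le_top
  · have hall : ∀ y, Φ y = ⊤ := fun y => h y fun hy => hne ⟨y, hy⟩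
    exact ⟨Classical.arbitrary Y, by simp [hall]⟩

open Classical in
theorem LowerSemicontinuous.ite_top {X : Type*} [TopologicalSpace X] {φ : X → EReal}
    (hφ : LowerSemicontinuous φ) {S : Set X} (hS : IsClosed S) :
    LowerSemicontinuous fun x => if x ∈ S then φ x else ⊤ := by
  intro x c hc
  by_cases hx : x ∈ S
  · simp only [hx, if_true] at hc
    filter_upwards [hφ x c hc] with y hy
    split_ifs
    · exact hy
    · exact hy.trans_le le_top
  · simp only [hx, if_false] at hc
    filter_upwards [hS.isOpen_compl.mem_nhds hx] with y hy
    rwa [if_neg hy]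

/-! ### Extended-real bookkeeping -/

theorem exists_coe_eq {a : EReal} (h1 : ⊥ < a) (h2 : a < ⊤) : ∃ r : ℝ, a = r :=
  ⟨a.toReal, (EReal.coe_toReal h2.ne h1.ne').symm⟩

/-- To bound an extended real below it suffices to look at the reals above it. -/
theorem le_of_forall_coe {a b : EReal} (h : ∀ r : ℝ, b ≤ r → a ≤ r) : a ≤ b :=
  EReal.le_of_forall_lt_iff_le.1 fun r hr => h r hr.le

theorem exists_coe_of_add_le {a b : EReal} (ha : ⊥ < a) (hb : ⊥ < b) {r : ℝ}
    (h : a + b ≤ r) : ∃ a' b' : ℝ, a = a' ∧ b = b' ∧ a' + b' ≤ r := by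
  have ha' : a < ⊤ := by
    rw [lt_top_iff_ne_top]; rintro rfl
    rw [EReal.top_add_of_ne_bot hb.ne'] at h
    exact absurd (h.trans_lt (EReal.coe_lt_top r)) (lt_irrefl _)
  have hb' : b < ⊤ := by
    rw [lt_top_iff_ne_top]; rintro rfl
    rw [EReal.add_top_of_ne_bot ha.ne'] at h
    exact absurd (h.trans_lt (EReal.coe_lt_top r)) (lt_irrefl _)
  obtain ⟨a', rfl⟩ := exists_coe_eq ha ha'
  obtain ⟨b', rfl⟩ := exists_coe_eq hb hb'
  exact ⟨a', b', rfl, rfl, by exact_mod_cast h⟩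

theorem lt_top_of_add_lt_top {a b : EReal} (ha : ⊥ < a) (hb : ⊥ < b) (h : a + b < ⊤) :
    a < ⊤ ∧ b < ⊤ := by
  obtain ⟨r, hr⟩ := exists_coe_eq (EReal.bot_lt_add_iff.2 ⟨ha, hb⟩) h
  obtain ⟨a', b', rfl, rfl, -⟩ := exists_coe_of_add_le ha hb hr.le
  exact ⟨EReal.coe_lt_top _, EReal.coe_lt_top _⟩

/-! ### Hamiltonians and joint subgradients -/

section Bolza

variable {E : Type*} [NormedAddCommGroup E] [InnerProductSpace ℝ E]

/-- A closed convex epigraph contains `(v, ⟪p, v⟫ - c)` when `v` is a subgradient at `p` of its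
support function. -/
theorem mem_epigraph_of_support [CompleteSpace E] {C : Set (E × ℝ)} (hC : IsClosed C)
    (hconv : Convex ℝ C) (hup : ∀ w r r', (w, r) ∈ C → r ≤ r' → (w, r') ∈ C) (hne : C.Nonempty)
    {p v : E} {c : ℝ} (h1 : ∀ z ∈ C, inner ℝ p z.1 - z.2 ≤ c)
    (h2 : ∀ q c', (∀ z ∈ C, inner ℝ q z.1 - z.2 ≤ c') → c + inner ℝ v (q - p) ≤ c') :
    (v, inner ℝ p v - c) ∈ C := by
  by_contra hv
  obtain ⟨F, s, hFv, hFC⟩ := geometric_hahn_banach_point_closed hconv hC hv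
  set a : E := (InnerProductSpace.toDual ℝ E).symm (F.comp (ContinuousLinearMap.inl ℝ E ℝ)) with ha
  set b : ℝ := F (0, 1) with hb
  have hF : ∀ w r, F (w, r) = inner ℝ a w + b * r := fun w r => by
    have e1 : inner ℝ a w = F (w, 0) := by
      rw [ha, InnerProductSpace.toDual_symm_apply]; rfl
    have e2 : b * r = F (0, r) := by
      rw [hb, mul_comm, ← smul_eq_mul, ← map_smul]; simp
    rw [e1, e2, ← map_add]; simp
  have hFC' : ∀ z ∈ C, s < inner ℝ a z.1 + b * z.2 := fun z hz => by
    rw [← hF]; exact hFC z hz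
  rw [hF] at hFv
  rcases lt_trichotomy b 0 with hb0 | hb0 | hb0
  -- A negative b is impossible: raising a point of the epigraph far enough violates the separation.
  · obtain ⟨⟨w, r⟩, hz⟩ := hne
    have h3 := hFC' _ hz
    dsimp only at h3
    have hk : r ≤ r + (inner ℝ a w + b * r - s) / (-b) := by
      have : 0 < (inner ℝ a w + b * r - s) / (-b) := div_pos (by linarith) (by linarith)
      linarith
    have h4 := hFC' _ (hup _ _ _ hz hk)
    dsimp only at h4
    have : b * ((inner ℝ a w + b * r - s) / (-b)) = -(inner ℝ a w + b * r - s) := by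
      rw [div_neg, mul_neg, mul_div_cancel₀ _ hb0.ne]
    rw [mul_add, this] at h4
    linarith
  -- Vertical hyperplane: moving p to p - a lowers the support bound by s, whereas the subgradient v
  -- allows a drop of at most ⟪a, v⟫ < s.
  · have h3 := h2 (p - a) (c - s) fun z hz => by
      have h4 := h1 z hz
      have h5 := hFC' z hz
      rw [hb0, zero_mul] at h5
      rw [inner_sub_left]; linarith
    rw [sub_sub_cancel_left, inner_neg_right, real_inner_comm] at h3
    rw [hb0, zero_mul] at hFv
    linarith
  -- Normalizing b to 1 makes the hyperplane an affine minorant of slope -b⁻¹a; test the subgradient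
  -- inequality at that slope.
  · have h3 := h2 (-(b⁻¹ • a)) (-(b⁻¹ * s)) fun z hz => by
      have h5 := hFC' z hz
      have h6 : b⁻¹ * s ≤ b⁻¹ * (inner ℝ a z.1 + b * z.2) :=
        mul_le_mul_of_nonneg_left h5.le (inv_nonneg.2 hb0.le)
      rw [mul_add, inv_mul_cancel_left₀ hb0.ne'] at h6
      rw [inner_neg_left, real_inner_smul_left]; linarith
    rw [inner_sub_right, inner_neg_right, real_inner_smul_right, real_inner_comm,
      real_inner_comm p v] at h3
    have h7 : b⁻¹ * (inner ℝ a v + b * (inner ℝ p v - c)) < b⁻¹ * s :=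
      mul_lt_mul_of_pos_left hFv (inv_pos.2 hb0)
    rw [mul_add, inv_mul_cancel_left₀ hb0.ne'] at h7
    linarith

/-- `(a, p)` is a subgradient of the function `(x, v) ↦ l x v`. -/
def IsJointSubgradient (l : E → E → EReal) (x v a p : E) : Prop :=
  l x v < ⊤ ∧ ∀ x' v', l x v + ((inner ℝ a (x' - x) + inner ℝ p (v' - v) : ℝ) : EReal) ≤ l x' v'

/-- Turns the extended-real supremum into real inequalities over the epigraph of `L t x`. -/
theorem hamiltonian_le_coe_iff {L : ℕ → E → E → EReal} {t : ℕ} {x p : E} {c : ℝ} :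
    hamiltonian L t x p ≤ c ↔ ∀ v (r : ℝ), L t x v ≤ r → inner ℝ p v - r ≤ c := by
  rw [hamiltonian, iSup_le_iff]
  refine forall_congr' fun v => ⟨fun h r hr => ?_, fun h => ?_⟩
  · have := (EReal.sub_le_sub le_rfl hr).trans h
    exact_mod_cast this
  · induction hl : L t x v with
    | bot =>
      have := h (inner ℝ p v - c - 1) (hl ▸ bot_le)
      linarith
    | top => simp
    | coe l => exact_mod_cast h l hl.le

/-- The p-inclusion gives equality in Fenchel's inequality at (v, p), by biconjugation of the closed
convex `L t x`. The x-inclusion bounds H(x', p) by H(x, p) - a·(x' - x), which is the joint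
subgradient inequality after unfolding the supremum. -/
theorem mem_saddleSubdiff_hamiltonian_iff [CompleteSpace E] {L : ℕ → E → E → EReal} {t : ℕ}
    (hconv : IsConvexFun fun q : E × E => L t q.1 q.2)
    (hlsc : LowerSemicontinuous fun q : E × E => L t q.1 q.2) (hbot : ∀ x v, ⊥ < L t x v)
    {x v a p : E} :
    (-a, v) ∈ saddleSubdiff (hamiltonian L t) x p ↔ IsJointSubgradient (L t) x v a p := by
  constructor
  · rintro ⟨⟨hx, hxa⟩, hp, hpv⟩
    simp only [neg_neg] at hxa
    -- Membership of x in the domain of -H(·, p) excludes -∞, and membership of p in that of H(x, ·)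
    -- excludes +∞.
    obtain ⟨c, hc⟩ : ∃ c : ℝ, hamiltonian L t x p = c := by
      refine exists_coe_eq (bot_lt_iff_ne_bot.2 fun h => ?_) hp
      simp [dom, h] at hx
    rw [hc] at hpv hxa
    have hbd : ∀ x' v' (r : ℝ), L t x' v' ≤ r →
        inner ℝ p v' - r ≤ c - inner ℝ a (x' - x) := by
      intro x' v' r hr
      refine hamiltonian_le_coe_iff.1 ?_ v' r hr
      rw [← EReal.neg_le_neg_iff]
      convert hxa x' using 1
      norm_cast
      ring
    have hup : ∀ w r r', (w, r) ∈ {z : E × ℝ | L t x z.1 ≤ (z.2 : EReal)} → r ≤ r' →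
        (w, r') ∈ {z : E × ℝ | L t x z.1 ≤ (z.2 : EReal)} := fun w r r' hr hrr' =>
      le_trans (show L t x w ≤ r from hr) (by exact_mod_cast hrr')
    have hmem : (v, inner ℝ p v - c) ∈ {z : E × ℝ | L t x z.1 ≤ (z.2 : EReal)} := by
      refine mem_epigraph_of_support ?_ ?_ hup ?_ (p := p) (c := c) ?_ ?_
      · have hcl := hlsc.isClosed_epigraph.preimage
          (f := fun z : E × ℝ => (((x, z.1) : E × E), (z.2 : EReal)))
          (by have := continuous_coe_real_ereal; fun_prop)
        exact hcl
      · intro z₁ h₁ z₂ h₂ α β hα hβ hαβ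
        have := hconv (x := ((x, z₁.1), z₁.2)) h₁ (y := ((x, z₂.1), z₂.2)) h₂ hα hβ hαβ
        simpa [← add_smul, hαβ] using this
      · by_contra hne
        rw [Set.not_nonempty_iff_eq_empty] at hne
        have : hamiltonian L t x p ≤ ((c - 1 : ℝ) : EReal) :=
          hamiltonian_le_coe_iff.2 fun w r hr =>
            absurd (show (w, r) ∈ {z : E × ℝ | L t x z.1 ≤ (z.2 : EReal)} from hr)
              (by rw [hne]; exact Set.notMem_empty _)
        rw [hc, EReal.coe_le_coe_iff] at this
        linarith
      · intro z hz
        simpa using hbd x z.1 z.2 hz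
      · intro q c' hq
        have h1 : hamiltonian L t x q ≤ c' :=
          hamiltonian_le_coe_iff.2 fun w r hr => hq (w, r) hr
        exact_mod_cast (hpv q).trans h1
    have hle : L t x v ≤ ((inner ℝ p v - c : ℝ) : EReal) := hmem
    refine ⟨hle.trans_lt (EReal.coe_lt_top _), fun x' v' => le_of_forall_coe fun r hr => ?_⟩
    refine (add_le_add_left hle _).trans ?_
    have := hbd x' v' r hr
    norm_cast
    rw [inner_sub_right p]
    linarith
  · rintro ⟨hlt, hle⟩
    obtain ⟨l, hl⟩ := exists_coe_eq (hbot x v) hlt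
    have hbd : ∀ x' v' (r : ℝ), L t x' v' ≤ r →
        inner ℝ p v' - r ≤ inner ℝ p v - l - inner ℝ a (x' - x) := by
      intro x' v' r hr
      have := (hle x' v').trans hr
      rw [hl] at this
      norm_cast at this
      rw [inner_sub_right p] at this
      linarith
    have hc : hamiltonian L t x p = ((inner ℝ p v - l : ℝ) : EReal) := by
      refine le_antisymm (hamiltonian_le_coe_iff.2 fun w r hr => by simpa using hbd x w r hr) ?_
      refine le_trans ?_ (le_iSup _ v)
      rw [hl]; norm_cast
    refine ⟨⟨?_, fun z => ?_⟩, ?_, fun q => ?_⟩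
    · simp only [dom, hc, mem_ofPred_eq]
      exact_mod_cast EReal.coe_lt_top _
    · have h : hamiltonian L t z p ≤ ((inner ℝ p v - l - inner ℝ a (z - x) : ℝ) : EReal) :=
        hamiltonian_le_coe_iff.2 fun w r hr => hbd z w r hr
      simp only [hc, neg_neg]
      rw [EReal.le_neg]
      refine h.trans (le_of_eq ?_)
      norm_cast
      ring
    · change hamiltonian L t x p < ⊤
      rw [hc]
      exact EReal.coe_lt_top _
    · refine le_trans ?_ (le_iSup _ v)
      rw [hc, hl]
      norm_cast
      rw [inner_sub_right, real_inner_comm q v, real_inner_comm p v]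
      linarith

/-! ### One step of the Bolza problem -/

/-- Splitting a subgradient of the infimal composition of `l` and `θ` by a multiplier. -/
theorem exists_multiplier [FiniteDimensional ℝ E] {l : E → E → EReal} {θ : E → EReal}
    (hl : IsConvexFun fun q : E × E => l q.1 q.2) (hlb : ∀ x v, ⊥ < l x v)
    (hθ : IsConvexFun θ) (hθb : ∀ y, ⊥ < θ y) {ξ v η : E} (hlt : l ξ v < ⊤)
    (hθt : θ (ξ + v) < ⊤)
    (hmin : ∀ x w, l ξ v + θ (ξ + v) + ((inner ℝ η (x - ξ) : ℝ) : EReal) ≤ l x w + θ (x + w))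
    {x₀ v₀ : E} (h1 : (x₀, v₀) ∈ relCore {q : E × E | l q.1 q.2 < ⊤})
    (h2 : x₀ + v₀ ∈ relCore (dom θ)) :
    ∃ p, IsJointSubgradient l ξ v (p + η) p ∧ -p ∈ subdiff θ (ξ + v) := by
  obtain ⟨l₀, hl₀⟩ := exists_coe_eq (hlb ξ v) hlt
  obtain ⟨θ₀, hθ₀⟩ := exists_coe_eq (hθb (ξ + v)) hθt
  -- The perturbed problem: the first component is the violation of y = x + w, the second an upper
  -- bound for the cost tilted by η.
  let G : Set (E × ℝ) := {z | ∃ x w y : E, ∃ a b : ℝ, l x w ≤ a ∧ θ y ≤ b ∧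
    z = (y - x - w, a + b - inner ℝ η x)}
  have hG : Convex ℝ G := by
    rintro _ ⟨x, w, y, a, b, ha, hb, rfl⟩ _ ⟨x', w', y', a', b', ha', hb', rfl⟩ α β hα hβ hαβ
    have k1 := hl (x := ((x, w), a)) ha (y := ((x', w'), a')) ha' hα hβ hαβ
    have k2 := hθ (x := (y, b)) hb (y := (y', b')) hb' hα hβ hαβ
    refine ⟨α • x + β • x', α • w + β • w', α • y + β • y', α * a + β * a', α * b + β * b',
      k1, k2, ?_⟩
    ext1
    · simp only [Prod.fst_add, Prod.smul_fst]
      module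
    · simp only [Prod.snd_add, Prod.smul_snd, smul_eq_mul, inner_add_right,
        real_inner_smul_right]
      ring
  obtain ⟨f, hf⟩ := exists_linearMap_le_of_convex hG (r₀ := l₀ + θ₀ - inner ℝ η ξ)
    ⟨ξ, v, ξ + v, l₀, θ₀, hl₀.le, hθ₀.le, by simp⟩
    (by
      rintro r ⟨x, w, y, a, b, ha, hb, hr⟩
      obtain ⟨hy, rfl⟩ := Prod.ext_iff.1 hr
      obtain rfl : y = x + w := by
        rw [← sub_eq_zero, ← sub_sub]; exact hy.symm
      have h := (hmin x w).trans (add_le_add ha hb)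
      rw [hl₀, hθ₀] at h
      norm_cast at h
      rw [inner_sub_right] at h
      dsimp only
      linarith)
    -- Reflecting (x, w) and y through the core points with a common ε multiplies the violation by
    -- -ε, since the core points violate nothing.
    (by
      rintro _ ⟨x, w, y, a, b, ha, hb, rfl⟩
      have e1 := h1.2 (x, w) (ha.trans_lt (EReal.coe_lt_top a))
      have e2 := h2.2 y (hb.trans_lt (EReal.coe_lt_top b))
      obtain ⟨ε, ⟨k1, k2⟩, hε⟩ := ((e1.and e2).and self_mem_nhdsWithin).exists
      obtain ⟨a', ha'⟩ := exists_coe_eq (hlb _ _) k1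
      obtain ⟨b', hb'⟩ := exists_coe_eq (hθb _) k2
      refine ⟨ε, hε, _, _, _, _, a', b', ha'.le, hb'.le, Prod.ext ?_ rfl⟩
      simp only [Prod.fst_add, Prod.snd_add, Prod.smul_fst, Prod.smul_snd, Prod.fst_sub,
        Prod.snd_sub]
      module)
  set q : E := (InnerProductSpace.toDual ℝ E).symm f.toContinuousLinearMap with hq
  have hfq : ∀ w, f w = inner ℝ q w := fun w => by
    rw [hq, InnerProductSpace.toDual_symm_apply]; rfl
  have key : ∀ x w y (a b : ℝ), l x w ≤ a → θ y ≤ b →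
      l₀ + θ₀ - inner ℝ η ξ + inner ℝ q (y - x - w) ≤ a + b - inner ℝ η x :=
    fun x w y a b ha hb => hfq _ ▸ hf _ ⟨x, w, y, a, b, ha, hb, rfl⟩
  refine ⟨-q, ⟨hlt, fun x w => le_of_forall_coe fun a ha => ?_⟩, hθt,
    fun y => le_of_forall_coe fun b hb => ?_⟩
  · have h := key x w (ξ + v) a θ₀ ha hθ₀.le
    rw [hl₀]
    norm_cast
    simp only [inner_sub_right, inner_add_right, inner_add_left, inner_neg_left] at h ⊢
    linarith
  · have h := key ξ v y l₀ b hl₀.le hb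
    rw [hθ₀]
    norm_cast
    simp only [inner_sub_right, inner_add_right, neg_neg] at h ⊢
    linarith

/-! ### Dynamic programming for the Bolza problem -/

/-- The cost of an arc on `{τ, …, T}`. -/
def bolzaCost (T : ℕ) (L : ℕ → E → E → EReal) (g : E → EReal) (τ : ℕ) (x : ℕ → E) : EReal :=
  (∑ t ∈ Finset.Ico τ T, L (t + 1) (x t) (x (t + 1) - x t)) + g (x T)

variable {T : ℕ} {L : ℕ → E → E → EReal} {g : E → EReal}

omit [InnerProductSpace ℝ E] in
theorem bolzaValue_le (τ : ℕ) (x : ℕ → E) :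
    bolzaValue T L g τ (x τ) ≤ bolzaCost T L g τ x :=
  iInf₂_le (f := fun (y : ℕ → E) (_ : y τ = x τ) => bolzaCost T L g τ y) x rfl

omit [InnerProductSpace ℝ E] in
theorem bolzaCost_succ {τ : ℕ} (hτ : τ < T) (x : ℕ → E) :
    bolzaCost T L g τ x =
      L (τ + 1) (x τ) (x (τ + 1) - x τ) + bolzaCost T L g (τ + 1) x := by
  rw [bolzaCost, Finset.sum_eq_sum_Ico_succ_bot hτ, add_assoc]; rfl

omit [InnerProductSpace ℝ E] in
theorem bolzaValue_self (ξ : E) : bolzaValue T L g T ξ = g ξ := by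
  refine le_antisymm (le_trans (bolzaValue_le T fun _ => ξ) (by simp [bolzaCost])) ?_
  refine le_iInf₂ fun x hx => ?_
  simp [hx]

omit [InnerProductSpace ℝ E] in
/-- The cost of an arc depends only on its values from the initial time on. -/
theorem bolzaCost_congr {τ : ℕ} (hτ : τ ≤ T) {x y : ℕ → E} (h : ∀ t, τ ≤ t → x t = y t) :
    bolzaCost T L g τ x = bolzaCost T L g τ y := by
  rw [bolzaCost, bolzaCost, h T hτ]
  congr 1
  refine Finset.sum_congr rfl fun t ht => ?_
  have := (Finset.mem_Ico.1 ht).1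
  rw [h t this, h (t + 1) (by omega)]

variable (T L g) in
/-- An optimal arc exists from every initial state at time `τ`. -/
def IsAttained (τ : ℕ) : Prop :=
  ∀ ξ : E, ∃ x : ℕ → E, x τ = ξ ∧ bolzaCost T L g τ x = bolzaValue T L g τ ξ

-- Attainment at τ + 1 provides an arc realizing the tail value, so no infimum has to be moved
-- through extended-real addition.
omit [InnerProductSpace ℝ E] in
theorem bolzaValue_eq_iInf {τ : ℕ} (hτ : τ < T) (hatt : IsAttained T L g (τ + 1)) (ξ : E) :
    bolzaValue T L g τ ξ = ⨅ y, L (τ + 1) ξ (y - ξ) + bolzaValue T L g (τ + 1) y := by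
  refine le_antisymm (le_iInf fun y => ?_) (le_iInf₂ fun x hx => ?_)
  · obtain ⟨x, hx, hc⟩ := hatt y
    have h := bolzaValue_le (T := T) (L := L) (g := g) τ (Function.update x τ ξ)
    rw [bolzaCost_succ hτ, bolzaCost_congr (y := x) (by omega) (fun t ht => by
      rw [Function.update_of_ne (by omega)]), hc, Function.update_self,
      Function.update_of_ne (by omega), hx] at h
    exact h
  · subst hx
    refine (iInf_le _ (x (τ + 1))).trans ?_
    change _ ≤ bolzaCost T L g τ x
    rw [bolzaCost_succ hτ]
    exact add_le_add_right (bolzaValue_le _ x) _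

/-- A Lagrangian that is proper, convex, lsc and has locally bounded velocities. -/
structure IsRegularLagrangian (l : E → E → EReal) : Prop where
  pcl : IsProperConvexLsc fun q : E × E => l q.1 q.2
  bdd : ∀ x₀, ∃ R : ℝ, ∀ᶠ x in 𝓝 x₀, ∀ v, l x v < ⊤ → ‖v‖ ≤ R

theorem IsRegularLagrangian.bot_lt {l : E → E → EReal} (hl : IsRegularLagrangian l) (x v : E) :
    ⊥ < l x v := hl.pcl.proper.2 (x, v)

variable (T L g) in
/-- The value function at time `τ` is convex, lsc, never `-∞`, and attained. -/
structure IsRegularValue (τ : ℕ) : Prop where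
  convex : IsConvexFun (bolzaValue T L g τ)
  lsc : LowerSemicontinuous (bolzaValue T L g τ)
  bot_lt : ∀ ξ, ⊥ < bolzaValue T L g τ ξ
  att : IsAttained T L g τ

omit [InnerProductSpace ℝ E] in
theorem lowerSemicontinuous_step {l : E → E → EReal} {θ : E → EReal}
    (hl : LowerSemicontinuous fun q : E × E => l q.1 q.2) (hlb : ∀ x v, ⊥ < l x v)
    (hθ : LowerSemicontinuous θ) (hθb : ∀ y, ⊥ < θ y) :
    LowerSemicontinuous fun q : E × E => l q.1 (q.2 - q.1) + θ q.2 := by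
  refine LowerSemicontinuous.add' ?_ (hθ.comp continuous_snd) fun q =>
    EReal.continuousAt_add (Or.inr (hθb _).ne') (Or.inl (hlb _ _).ne')
  exact hl.comp (g := fun q : E × E => (q.1, q.2 - q.1)) (by fun_prop)

/-- Bounded velocities confine the successors of all states near x₀ to one ball; the extra 1 in the
radius absorbs the motion of x. -/
theorem IsRegularLagrangian.eventually_top [FiniteDimensional ℝ E] {l : E → E → EReal}
    (hl : IsRegularLagrangian l) {θ : E → EReal} (hθb : ∀ y, ⊥ < θ y) (x₀ : E) :
    ∃ K : Set E, IsCompact K ∧ ∀ᶠ x in 𝓝 x₀, ∀ y ∉ K, l x (y - x) + θ y = ⊤ := by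
  have := FiniteDimensional.proper ℝ E
  obtain ⟨R, hR⟩ := hl.bdd x₀
  refine ⟨Metric.closedBall x₀ (R + 1), isCompact_closedBall _ _, ?_⟩
  filter_upwards [hR, Metric.ball_mem_nhds x₀ one_pos] with x hx hx1 y hy
  by_contra hne
  have h := (lt_top_of_add_lt_top (hl.bot_lt _ _) (hθb y) (lt_top_iff_ne_top.2 hne)).1
  refine hy (Metric.mem_closedBall.2 ?_)
  have h2 := hx _ h
  rw [Metric.mem_ball] at hx1
  rw [← dist_eq_norm] at h2
  linarith [dist_triangle y x x₀]

theorem IsRegularValue.exists_step [FiniteDimensional ℝ E] {τ : ℕ} (hτ : τ < T)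
    (hL : IsRegularLagrangian (L (τ + 1))) (h : IsRegularValue T L g (τ + 1)) (ξ : E) :
    ∃ y, bolzaValue T L g τ ξ = L (τ + 1) ξ (y - ξ) + bolzaValue T L g (τ + 1) y := by
  obtain ⟨K, hK, hKx⟩ := hL.eventually_top h.bot_lt ξ
  have hlsc := (lowerSemicontinuous_step hL.pcl.lsc hL.bot_lt h.lsc h.bot_lt).comp
    (g := fun y : E => (ξ, y)) (by fun_prop)
  obtain ⟨y, hy⟩ := exists_eq_iInf_of_compact hlsc hK hKx.self_of_nhds
  exact ⟨y, (bolzaValue_eq_iInf hτ h.att ξ).trans hy.symm⟩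

theorem IsRegularValue.le_step {τ : ℕ} (hτ : τ < T)
    (h : IsRegularValue T L g (τ + 1)) (ξ y : E) :
    bolzaValue T L g τ ξ ≤ L (τ + 1) ξ (y - ξ) + bolzaValue T L g (τ + 1) y :=
  (bolzaValue_eq_iInf hτ h.att ξ).trans_le (iInf_le _ y)

/-- Interpolating minimizing successors gives a competitor, hence convexity; prepending ξ to an
optimal tail gives attainment. -/
theorem IsRegularValue.step [FiniteDimensional ℝ E] {τ : ℕ} (hτ : τ < T)
    (hL : IsRegularLagrangian (L (τ + 1))) (h : IsRegularValue T L g (τ + 1)) :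
    IsRegularValue T L g τ where
  convex := by
    rintro ⟨x, r⟩ hr ⟨x', r'⟩ hr' α β hα hβ hαβ
    obtain ⟨y, hy⟩ := h.exists_step hτ hL x
    obtain ⟨y', hy'⟩ := h.exists_step hτ hL x'
    obtain ⟨a, b, ha, hb, hab⟩ := exists_coe_of_add_le (hL.bot_lt _ _) (h.bot_lt _)
      (hy.symm.trans_le hr)
    obtain ⟨a', b', ha', hb', hab'⟩ := exists_coe_of_add_le (hL.bot_lt _ _) (h.bot_lt _)
      (hy'.symm.trans_le hr')
    have k1 := hL.pcl.convex (x := ((x, y - x), a)) ha.le (y := ((x', y' - x'), a')) ha'.le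
      hα hβ hαβ
    have k2 := h.convex (x := (y, b)) hb.le (y := (y', b')) hb'.le hα hβ hαβ
    refine (h.le_step hτ _ (α • y + β • y')).trans ?_
    have e : α • y + β • y' - (α • x + β • x') = α • (y - x) + β • (y' - x') := by module
    refine le_trans (b := ((α * a + β * a' : ℝ) : EReal) + ((α * b + β * b' : ℝ) : EReal))
      (add_le_add ?_ k2) ?_
    · rw [show (α • (x, r) + β • (x', r')).1 = α • x + β • x' from rfl, e]
      exact k1
    · norm_cast
      simp only [Prod.snd_add, Prod.smul_snd, smul_eq_mul]
      nlinarith [mul_le_mul_of_nonneg_left hab hα, mul_le_mul_of_nonneg_left hab' hβ]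
  lsc := by
    have : bolzaValue T L g τ =
        fun x => ⨅ y, L (τ + 1) x (y - x) + bolzaValue T L g (τ + 1) y :=
      funext (bolzaValue_eq_iInf hτ h.att)
    rw [this]
    exact lowerSemicontinuous_iInf_of_locally_compact
      (lowerSemicontinuous_step hL.pcl.lsc hL.bot_lt h.lsc h.bot_lt)
      (hL.eventually_top h.bot_lt)
  bot_lt ξ := by
    obtain ⟨y, hy⟩ := h.exists_step hτ hL ξ
    rw [hy]
    exact EReal.bot_lt_add_iff.2 ⟨hL.bot_lt _ _, h.bot_lt _⟩
  att ξ := by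
    obtain ⟨y, hy⟩ := h.exists_step hτ hL ξ
    obtain ⟨x, hx, hc⟩ := h.att y
    refine ⟨Function.update x τ ξ, Function.update_self .., ?_⟩
    rw [bolzaCost_succ hτ, bolzaCost_congr (y := x) (by omega) (fun t ht => by
      rw [Function.update_of_ne (by omega)]), hc, Function.update_self,
      Function.update_of_ne (by omega), hx, hy]

theorem isRegularValue [FiniteDimensional ℝ E] (hL : ∀ t < T, IsRegularLagrangian (L (t + 1)))
    (hg : IsProperConvexLsc g) {τ : ℕ} (hτ : τ ≤ T) : IsRegularValue T L g τ := by
  induction hτ using Nat.decreasingInduction with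
  | of_succ k hk ih => exact ih.step hk (hL k hk)
  | self =>
    have h : bolzaValue T L g T = g := funext bolzaValue_self
    refine ⟨by rw [h]; exact hg.convex, by rw [h]; exact hg.lsc,
      fun ξ => by rw [h]; exact hg.proper.2 ξ, fun ξ => ⟨fun _ => ξ, rfl, ?_⟩⟩
    rw [h]
    simp [bolzaCost]

/-! ### Characteristics and subgradients of the value function -/

/-- Add both subgradient inequalities at a minimizing successor of z: the p-terms cancel and only
η·(z - ξ) survives. -/
theorem IsRegularValue.subgradient_step {τ : ℕ} [FiniteDimensional ℝ E] (hτ : τ < T)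
    (hL : IsRegularLagrangian (L (τ + 1))) (h : IsRegularValue T L g (τ + 1)) {ξ v η p : E}
    (h1 : IsJointSubgradient (L (τ + 1)) ξ v (p + η) p)
    (h2 : -p ∈ subdiff (bolzaValue T L g (τ + 1)) (ξ + v)) :
    η ∈ subdiff (bolzaValue T L g τ) ξ := by
  have hle := h.le_step hτ ξ (ξ + v)
  rw [add_sub_cancel_left] at hle
  obtain ⟨l₀, hl₀⟩ := exists_coe_eq (hL.bot_lt ξ v) h1.1
  obtain ⟨θ₀, hθ₀⟩ := exists_coe_eq (h.bot_lt (ξ + v)) h2.1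
  refine ⟨hle.trans_lt (EReal.add_lt_top h1.1.ne h2.1.ne), fun z => ?_⟩
  obtain ⟨y, hy⟩ := h.exists_step hτ hL z
  rw [hy]
  refine le_trans ?_ (add_le_add (h1.2 z (y - z)) (h2.2 y))
  refine (add_le_add_left hle _).trans (le_of_eq ?_)
  rw [hl₀, hθ₀]
  norm_cast
  simp only [inner_sub_right, inner_add_right, inner_add_left, inner_neg_left]
  ring

theorem mem_subdiff_bolzaValue_of_trajectory [FiniteDimensional ℝ E]
    (hL : ∀ t < T, IsRegularLagrangian (L (t + 1))) (hg : IsProperConvexLsc g) {x p : ℕ → E}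
    (hT : -p T ∈ subdiff g (x T)) {τ : ℕ} (hτ : τ ≤ T)
    (hH : IsHamiltonianTrajectory T L τ x p) :
    -p τ ∈ subdiff (bolzaValue T L g τ) (x τ) := by
  induction hτ using Nat.decreasingInduction with
  | of_succ k hk ih =>
    have ih' := ih fun t ht => hH t (by rw [Finset.mem_Ico] at ht ⊢; omega)
    have h1 := hH k (by rw [Finset.mem_Ico]; omega)
    have hLk := hL k hk
    rw [mem_saddleSubdiff_hamiltonian_iff hLk.pcl.convex hLk.pcl.lsc hLk.bot_lt] at h1
    refine (isRegularValue hL hg hk).subgradient_step hk hLk (v := x (k + 1) - x k)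
      (p := p (k + 1)) ?_ ?_
    · rwa [← sub_eq_add_neg]
    · rwa [add_sub_cancel]
  | self => rwa [show bolzaValue T L g T = g from funext bolzaValue_self]

/-- The effective domain is a projection of admissible pairs (z, y): prolonging the step and its
tail with the same δ keeps both admissible. -/
theorem mem_relCore_dom_bolzaValue [FiniteDimensional ℝ E]
    (hL : ∀ t < T, IsRegularLagrangian (L (t + 1))) (hg : IsProperConvexLsc g) {x : ℕ → E}
    (hT : x T ∈ relCore (dom g)) {τ : ℕ} (hτ : τ ≤ T)
    (hx : ∀ t ∈ Finset.Ico τ T,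
      (x t, x (t + 1) - x t) ∈ relCore {q : E × E | L (t + 1) q.1 q.2 < ⊤}) :
    x τ ∈ relCore (dom (bolzaValue T L g τ)) := by
  induction hτ using Nat.decreasingInduction with
  | of_succ k hk ih =>
    have ih' := ih fun t ht => hx t (by rw [Finset.mem_Ico] at ht ⊢; omega)
    have h1 := hx k (by rw [Finset.mem_Ico]; omega)
    have hreg := isRegularValue hL hg hk
    have hdom : ∀ a b, L (k + 1) a (b - a) < ⊤ → bolzaValue T L g (k + 1) b < ⊤ →
        bolzaValue T L g k a < ⊤ := fun a b ha hb =>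
      (hreg.le_step hk a b).trans_lt (EReal.add_lt_top ha.ne hb.ne)
    refine ⟨hdom _ _ h1.1 ih'.1, fun z hz => ?_⟩
    obtain ⟨y, hy⟩ := hreg.exists_step hk (hL k hk) z
    have hz' : bolzaValue T L g k z < ⊤ := hz
    rw [hy] at hz'
    obtain ⟨hz1, hz2⟩ := lt_top_of_add_lt_top ((hL k hk).bot_lt _ _) (hreg.bot_lt _) hz'
    filter_upwards [h1.2 (z, y - z) hz1, ih'.2 y hz2] with δ k1 k2
    refine hdom _ _ ?_ k2
    convert k1 using 1
    simp only [Prod.snd_add, Prod.smul_snd, Prod.snd_sub, Prod.fst_add, Prod.smul_fst,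
      Prod.fst_sub]
    congr 1
    module
  | self => rwa [show bolzaValue T L g T = g from funext bolzaValue_self]

theorem hasCharacteristic_of_mem_subdiff [FiniteDimensional ℝ E]
    (hL : ∀ t < T, IsRegularLagrangian (L (t + 1))) (hg : IsProperConvexLsc g) {x₀ : ℕ → E}
    (hT : x₀ T ∈ relCore (dom g)) {τ : ℕ} (hτ : τ ≤ T)
    (hx : ∀ t ∈ Finset.Ico τ T,
      (x₀ t, x₀ (t + 1) - x₀ t) ∈ relCore {q : E × E | L (t + 1) q.1 q.2 < ⊤})
    {ξ η : E} (hη : η ∈ subdiff (bolzaValue T L g τ) ξ) : HasCharacteristic T L g τ ξ η := by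
  induction hτ using Nat.decreasingInduction generalizing ξ η with
  | of_succ k hk ih =>
    have hx' : ∀ t ∈ Finset.Ico (k + 1) T,
        (x₀ t, x₀ (t + 1) - x₀ t) ∈ relCore {q : E × E | L (t + 1) q.1 q.2 < ⊤} :=
      fun t ht => hx t (by rw [Finset.mem_Ico] at ht ⊢; omega)
    have h1 := hx k (by rw [Finset.mem_Ico]; omega)
    have h2 : x₀ (k + 1) ∈ relCore (dom (bolzaValue T L g (k + 1))) :=
      mem_relCore_dom_bolzaValue hL hg hT hk hx'
    have hreg : IsRegularValue T L g (k + 1) := isRegularValue hL hg hk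
    have hLk := hL k hk
    obtain ⟨y, hy⟩ := hreg.exists_step hk hLk ξ
    have hlt : bolzaValue T L g k ξ < ⊤ := hη.1
    rw [hy] at hlt
    obtain ⟨hlt1, hlt2⟩ := lt_top_of_add_lt_top (hLk.bot_lt _ _) (hreg.bot_lt _) hlt
    -- The core points belong to the Slater arc and need not be near the optimal step.
    obtain ⟨p₁, hp, hp'⟩ := exists_multiplier hLk.pcl.convex hLk.bot_lt hreg.convex hreg.bot_lt
      (ξ := ξ) (v := y - ξ) (η := η) hlt1 (by rwa [add_sub_cancel])
      (fun z w => by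
        have := (hη.2 z).trans (hreg.le_step hk z (z + w))
        rw [hy, add_sub_cancel_left] at this
        rwa [add_sub_cancel])
      h1 (by rwa [add_sub_cancel])
    obtain ⟨x, p, hH, hxk, hpk, hpT⟩ := ih hx' hp'
    rw [add_sub_cancel] at hxk
    rw [neg_neg] at hpk
    have hne : ∀ t, k + 1 ≤ t → t ≠ k := fun t ht => by omega
    -- The tail starts at (y, p₁), so setting p_k = -η makes -Δp equal to -(p₁ + η), as the saddle
    -- inclusion requires.
    refine ⟨Function.update x k ξ, Function.update p k (-η), fun t ht => ?_,
      Function.update_self .., Function.update_self .., ?_⟩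
    · rw [Finset.mem_Ico] at ht
      rcases ht.1.eq_or_lt with rfl | hkt
      · rw [Function.update_self, Function.update_self, Function.update_of_ne (by omega),
          Function.update_of_ne (by omega), hxk, hpk,
          mem_saddleSubdiff_hamiltonian_iff hLk.pcl.convex hLk.pcl.lsc hLk.bot_lt, sub_neg_eq_add]
        exact hp
      · rw [Function.update_of_ne (by omega), Function.update_of_ne (by omega),
          Function.update_of_ne (by omega), Function.update_of_ne (by omega)]
        exact hH t (by rw [Finset.mem_Ico]; omega)
    · rw [Function.update_of_ne (by omega), Function.update_of_ne (by omega)]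
      exact hpT
  | self =>
    rw [show bolzaValue T L g T = g from funext bolzaValue_self] at hη
    exact ⟨fun _ => ξ, fun _ => -η, fun t ht => by simp at ht, rfl, rfl, by rwa [neg_neg]⟩

end Bolza

namespace MixProblem

variable {n m : ℕ} (P : MixProblem n m)

local notation "𝔼" => EuclideanSpace ℝ

/-! ### The Lagrangian of the control problem -/

theorem continuous_velocity (t : ℕ) :
    Continuous fun q : 𝔼 (Fin n) × 𝔼 (Fin m) => P.velocity t q.1 q.2 := by
  have h1 : Continuous (Matrix.toEuclideanLin (P.A t)) := LinearMap.continuous_of_finiteDimensional _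
  have h2 : Continuous (Matrix.toEuclideanLin (P.B t)) := LinearMap.continuous_of_finiteDimensional _
  unfold velocity
  fun_prop

/-- No signs are required of α and β, so this serves extrapolation as well as convex combinations.
-/
theorem velocity_combo (t : ℕ) {x x' : 𝔼 (Fin n)} {u u' : 𝔼 (Fin m)} {α β : ℝ}
    (h : α + β = 1) : P.velocity t (α • x + β • x') (α • u + β • u') =
      α • P.velocity t x u + β • P.velocity t x' u' := by
  have : P.drift t = α • P.drift t + β • P.drift t := by rw [← add_smul, h, one_smul]
  simp only [velocity, map_add, map_smul]
  nth_rw 1 [this]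
  module

/-- The triples `((x, v), u)` with `(x, u) ∈ Ω_t` and `v = A_t x + B_t u + φ_t`. -/
def velocityGraph (t : ℕ) : Set ((𝔼 (Fin n) × 𝔼 (Fin n)) × 𝔼 (Fin m)) :=
  {q | (q.1.1, q.2) ∈ P.Omega t ∧ q.1.2 = P.velocity t q.1.1 q.2}

open Classical in
/-- The function whose partial infimum over the controls is `L_{t+1}`. -/
def integrand (t : ℕ) (q : (𝔼 (Fin n) × 𝔼 (Fin n)) × 𝔼 (Fin m)) : EReal :=
  if q ∈ P.velocityGraph t then (P.ℓ t q.1.1 q.2 : EReal) else ⊤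

theorem lagrangian_succ (t : ℕ) (x v : 𝔼 (Fin n)) :
    P.lagrangian (t + 1) x v = ⨅ u, P.integrand t ((x, v), u) := by
  refine iInf_congr fun u => ?_
  simp only [integrand, velocityGraph, Omega, indic, mem_ofPred_eq, add_tsub_cancel_right]
  by_cases h1 : x ∈ P.X t <;> by_cases h2 : u ∈ P.U t <;> by_cases h3 : P.f t x u ≤ 0 <;>
    by_cases h4 : v = P.velocity t x u <;> simp [h1, h2, h3, h4]

section Convex

variable {P}

theorem IsLinearConvex.continuous_cost (hP : P.IsLinearConvex) {t : ℕ} (ht : t < P.T) :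
    Continuous fun q : 𝔼 (Fin n) × 𝔼 (Fin m) => P.ℓ t q.1 q.2 :=
  continuousOn_univ.1 ((hP.ℓ_convex t ht).continuousOn isOpen_univ)

theorem IsLinearConvex.continuous_mixed (hP : P.IsLinearConvex) {t : ℕ} (ht : t < P.T) :
    Continuous fun q : 𝔼 (Fin n) × 𝔼 (Fin m) => P.f t q.1 q.2 :=
  continuousOn_univ.1 ((hP.f_convex t ht).continuousOn isOpen_univ)

theorem IsLinearConvex.convex_Omega (hP : P.IsLinearConvex) {t : ℕ} (ht : t < P.T) :
    Convex ℝ (P.Omega t) := by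
  rintro ⟨x, u⟩ ⟨h1, h2, h3⟩ ⟨x', u'⟩ ⟨h1', h2', h3'⟩ α β hα hβ hαβ
  refine ⟨hP.X_convex t ht.le h1 h1' hα hβ hαβ, hP.U_convex t ht h2 h2' hα hβ hαβ, ?_⟩
  have := (hP.f_convex t ht).2 (mem_univ (x, u)) (mem_univ (x', u')) hα hβ hαβ
  refine this.trans ?_
  simp only [smul_eq_mul] at h3 h3' ⊢
  nlinarith

theorem IsLinearConvex.isClosed_velocityGraph (hP : P.IsLinearConvex) {t : ℕ} (ht : t < P.T) :
    IsClosed (P.velocityGraph t) := by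
  have hc : Continuous fun q : (𝔼 (Fin n) × 𝔼 (Fin n)) × 𝔼 (Fin m) => (q.1.1, q.2) := by fun_prop
  have h1 : IsClosed {q : (𝔼 (Fin n) × 𝔼 (Fin n)) × 𝔼 (Fin m) | q.1.1 ∈ P.X t} :=
    (hP.X_closed t ht.le).preimage (by fun_prop)
  have h2 : IsClosed {q : (𝔼 (Fin n) × 𝔼 (Fin n)) × 𝔼 (Fin m) | q.2 ∈ P.U t} :=
    (hP.U_closed t ht).preimage (by fun_prop)
  have h3 : IsClosed {q : (𝔼 (Fin n) × 𝔼 (Fin n)) × 𝔼 (Fin m) | P.f t q.1.1 q.2 ≤ 0} :=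
    isClosed_Iic.preimage ((hP.continuous_mixed ht).comp hc)
  have hv := (P.continuous_velocity t).comp hc
  have h4 : IsClosed {q : (𝔼 (Fin n) × 𝔼 (Fin n)) × 𝔼 (Fin m) |
      q.1.2 = P.velocity t q.1.1 q.2} :=
    isClosed_eq (continuous_snd.comp continuous_fst) hv
  exact (h1.inter (h2.inter h3)).inter h4

theorem IsLinearConvex.lowerSemicontinuous_integrand (hP : P.IsLinearConvex) {t : ℕ}
    (ht : t < P.T) : LowerSemicontinuous (P.integrand t) := by
  have hc : Continuous fun q : (𝔼 (Fin n) × 𝔼 (Fin n)) × 𝔼 (Fin m) => (q.1.1, q.2) := by fun_prop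
  exact LowerSemicontinuous.ite_top (continuous_coe_real_ereal.comp
    ((hP.continuous_cost ht).comp hc)).lowerSemicontinuous (hP.isClosed_velocityGraph ht)

theorem mem_velocityGraph_of_integrand_ne_top {t : ℕ}
    {q : (𝔼 (Fin n) × 𝔼 (Fin n)) × 𝔼 (Fin m)} (h : P.integrand t q ≠ ⊤) :
    q ∈ P.velocityGraph t := by
  by_contra hq
  exact h (if_neg hq)

/-- Upper semicontinuity gives ψ < ψ(x₀) + 1 near x₀. -/
theorem CondA.eventually_norm_le {t : ℕ} (hA : P.CondA t) (x₀ : 𝔼 (Fin n)) :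
    ∃ R : ℝ, ∀ᶠ x in 𝓝 x₀, ∀ u, (x, u) ∈ P.Omega t → ‖u‖ ≤ R := by
  obtain ⟨ψ, hψ, h⟩ := hA
  refine ⟨ψ x₀ + 1, ?_⟩
  filter_upwards [hψ x₀ (ψ x₀ + 1) (by linarith)] with x hx u hu
  exact (h x hu.1 u hu.2.1 hu.2.2).trans (le_of_lt hx)

theorem CondA.eventually_integrand_eq_top {t : ℕ} (hA : P.CondA t) (q₀ : 𝔼 (Fin n) × 𝔼 (Fin n)) :
    ∃ K : Set (𝔼 (Fin m)), IsCompact K ∧ ∀ᶠ q in 𝓝 q₀, ∀ u ∉ K, P.integrand t (q, u) = ⊤ := by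
  obtain ⟨R, hR⟩ := hA.eventually_norm_le q₀.1
  refine ⟨Metric.closedBall 0 R, isCompact_closedBall _ _, ?_⟩
  filter_upwards [continuous_fst.continuousAt.eventually hR] with q hq u hu
  by_contra hne
  exact hu (mem_closedBall_zero_iff.2 (hq u (mem_velocityGraph_of_integrand_ne_top hne).1))

/-- The infimum over controls is attained, so the epigraph of the Lagrangian is exactly the
projection of admissible data. -/
theorem IsLinearConvex.lagrangian_le_coe_iff (hP : P.IsLinearConvex) {t : ℕ} (ht : t < P.T)
    (hA : P.CondA t) {x v : 𝔼 (Fin n)} {r : ℝ} : P.lagrangian (t + 1) x v ≤ r ↔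
      ∃ u, (x, u) ∈ P.Omega t ∧ v = P.velocity t x u ∧ P.ℓ t x u ≤ r := by
  rw [lagrangian_succ]
  constructor
  · intro h
    obtain ⟨K, hK, hKx⟩ := hA.eventually_integrand_eq_top (x, v)
    obtain ⟨u, hu⟩ := exists_eq_iInf_of_compact ((hP.lowerSemicontinuous_integrand ht).comp
      (g := fun u : 𝔼 (Fin m) => ((x, v), u)) (by fun_prop)) hK hKx.self_of_nhds
    have hle : P.integrand t ((x, v), u) ≤ r := hu.trans_le h
    have hmem := mem_velocityGraph_of_integrand_ne_top (hle.trans_lt (EReal.coe_lt_top r)).ne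
    rw [integrand, if_pos hmem] at hle
    exact ⟨u, hmem.1, hmem.2, by exact_mod_cast hle⟩
  · rintro ⟨u, h1, h2, h3⟩
    refine (iInf_le _ u).trans ?_
    rw [integrand, if_pos ⟨h1, h2⟩]
    exact_mod_cast h3

theorem IsLinearConvex.lagrangian_lt_top_iff (hP : P.IsLinearConvex) {t : ℕ} (ht : t < P.T)
    (hA : P.CondA t) {x v : 𝔼 (Fin n)} : P.lagrangian (t + 1) x v < ⊤ ↔
      ∃ u, (x, u) ∈ P.Omega t ∧ v = P.velocity t x u := by
  constructor
  · intro h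
    obtain ⟨r, hr, -⟩ := EReal.lt_iff_exists_real_btwn.1 h
    obtain ⟨u, h1, h2, -⟩ := (hP.lagrangian_le_coe_iff ht hA).1 hr.le
    exact ⟨u, h1, h2⟩
  · rintro ⟨u, h1, h2⟩
    exact ((hP.lagrangian_le_coe_iff ht hA).2 ⟨u, h1, h2, le_rfl⟩).trans_lt (EReal.coe_lt_top _)

theorem IsLinearConvex.bot_lt_lagrangian (hP : P.IsLinearConvex) {t : ℕ} (ht : t < P.T)
    (hA : P.CondA t) (x v : 𝔼 (Fin n)) : ⊥ < P.lagrangian (t + 1) x v := by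
  obtain ⟨K, hK, hKx⟩ := hA.eventually_integrand_eq_top (x, v)
  obtain ⟨u, hu⟩ := exists_eq_iInf_of_compact ((hP.lowerSemicontinuous_integrand ht).comp
    (g := fun u : 𝔼 (Fin m) => ((x, v), u)) (by fun_prop)) hK hKx.self_of_nhds
  rw [lagrangian_succ]
  refine lt_of_lt_of_eq ?_ hu
  change ⊥ < P.integrand t ((x, v), u)
  rw [integrand]
  split_ifs
  · exact EReal.bot_lt_coe _
  · exact bot_lt_top

theorem IsLinearConvex.isProperConvexLsc_lagrangian (hP : P.IsLinearConvex) {t : ℕ}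
    (ht : t < P.T) (hA : P.CondA t) (hΩ : (P.Omega t).Nonempty) :
    IsProperConvexLsc fun q : 𝔼 (Fin n) × 𝔼 (Fin n) => P.lagrangian (t + 1) q.1 q.2 where
  proper := by
    obtain ⟨⟨x, u⟩, hxu⟩ := hΩ
    exact ⟨⟨(x, P.velocity t x u), (hP.lagrangian_lt_top_iff ht hA).2 ⟨u, hxu, rfl⟩⟩,
      fun q => hP.bot_lt_lagrangian ht hA q.1 q.2⟩
  convex := by
    rintro ⟨⟨x, v⟩, r⟩ hr ⟨⟨x', v'⟩, r'⟩ hr' α β hα hβ hαβ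
    obtain ⟨u, h1, h2, h3⟩ := (hP.lagrangian_le_coe_iff ht hA).1 hr
    obtain ⟨u', h1', h2', h3'⟩ := (hP.lagrangian_le_coe_iff ht hA).1 hr'
    refine (hP.lagrangian_le_coe_iff ht hA).2 ⟨α • u + β • u',
      hP.convex_Omega ht h1 h1' hα hβ hαβ, ?_, ?_⟩
    · refine Eq.trans ?_ (P.velocity_combo t hαβ).symm
      dsimp only at h2 h2'
      rw [← h2, ← h2']
      rfl
    · refine ((hP.ℓ_convex t ht).2 (mem_univ (x, u)) (mem_univ (x', u')) hα hβ hαβ).trans ?_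
      exact add_le_add (mul_le_mul_of_nonneg_left h3 hα) (mul_le_mul_of_nonneg_left h3' hβ)
  lsc := by
    have : (fun q : 𝔼 (Fin n) × 𝔼 (Fin n) => P.lagrangian (t + 1) q.1 q.2) =
        fun q => ⨅ u, P.integrand t (q, u) := funext fun q => P.lagrangian_succ t q.1 q.2
    rw [this]
    exact lowerSemicontinuous_iInf_of_locally_compact (hP.lowerSemicontinuous_integrand ht)
      hA.eventually_integrand_eq_top

theorem IsLinearConvex.isRegularLagrangian (hP : P.IsLinearConvex) {t : ℕ}
    (ht : t < P.T) (hA : P.CondA t) (hΩ : (P.Omega t).Nonempty) :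
    IsRegularLagrangian (P.lagrangian (t + 1)) where
  pcl := hP.isProperConvexLsc_lagrangian ht hA hΩ
  bdd x₀ := by
    obtain ⟨R, hR⟩ := hA.eventually_norm_le x₀
    obtain ⟨M, hM⟩ := (((isCompact_closedBall x₀ 1).prod
      (isCompact_closedBall (0 : 𝔼 (Fin m)) R)).image
        (P.continuous_velocity t)).isBounded.exists_norm_le
    refine ⟨M, ?_⟩
    filter_upwards [hR, Metric.closedBall_mem_nhds x₀ one_pos] with x hx hx1 v hv
    obtain ⟨u, h1, rfl⟩ := (hP.lagrangian_lt_top_iff ht hA).1 hv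
    exact hM _ ⟨(x, u), ⟨hx1, mem_closedBall_zero_iff.2 (hx u h1)⟩, rfl⟩

/-! ### The terminal cost -/

open Classical in
theorem IsLinearConvex.terminalCost_apply (hP : P.IsLinearConvex) (x : 𝔼 (Fin n)) :
    P.terminalCost x = if x ∈ P.X P.T then P.g x else ⊤ := by
  rw [terminalCost, indic]
  split_ifs
  · rw [add_zero]
  · exact EReal.add_top_of_ne_bot (hP.g_pcl.proper.2 x).ne'

theorem IsLinearConvex.terminalCost_le_iff (hP : P.IsLinearConvex) {x : 𝔼 (Fin n)} {r : ℝ} :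
    P.terminalCost x ≤ r ↔ x ∈ P.X P.T ∧ P.g x ≤ r := by
  rw [hP.terminalCost_apply]
  split_ifs with h <;> simp [h]

theorem IsLinearConvex.dom_terminalCost (hP : P.IsLinearConvex) :
    dom P.terminalCost = P.X P.T ∩ dom P.g := by
  ext x
  simp only [dom, mem_ofPred_eq, mem_inter_iff, hP.terminalCost_apply]
  split_ifs with h <;> simp [h]

theorem IsLinearConvex.isProperConvexLsc_terminalCost (hP : P.IsLinearConvex)
    (hg : (P.X P.T ∩ dom P.g).Nonempty) : IsProperConvexLsc P.terminalCost where
  proper := by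
    refine ⟨hP.dom_terminalCost ▸ hg, fun x => ?_⟩
    rw [hP.terminalCost_apply]
    split_ifs
    · exact hP.g_pcl.proper.2 x
    · exact bot_lt_top
  convex := by
    rintro ⟨x, r⟩ hr ⟨x', r'⟩ hr' α β hα hβ hαβ
    obtain ⟨h1, h2⟩ := hP.terminalCost_le_iff.1 hr
    obtain ⟨h1', h2'⟩ := hP.terminalCost_le_iff.1 hr'
    exact hP.terminalCost_le_iff.2 ⟨hP.X_convex _ le_rfl h1 h1' hα hβ hαβ,
      hP.g_pcl.convex (x := (x, r)) h2 (y := (x', r')) h2' hα hβ hαβ⟩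
  lsc := by
    rw [funext hP.terminalCost_apply]
    exact LowerSemicontinuous.ite_top hP.g_pcl.lsc (hP.X_closed _ le_rfl)

/-! ### Equality of the values -/

theorem coe_finset_sum {ι : Type*} (s : Finset ι) (c : ι → ℝ) :
    ((∑ i ∈ s, c i : ℝ) : EReal) = ∑ i ∈ s, (c i : EReal) := by
  classical
  induction s using Finset.induction_on with
  | empty => simp
  | insert a s ha ih => rw [Finset.sum_insert ha, Finset.sum_insert ha, EReal.coe_add, ih]

theorem bot_lt_sum {ι : Type*} {s : Finset ι} {c : ι → EReal} (h : ∀ i ∈ s, ⊥ < c i) :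
    ⊥ < ∑ i ∈ s, c i :=
  Finset.sum_induction c (⊥ < ·) (fun _ _ ha hb => EReal.bot_lt_add_iff.2 ⟨ha, hb⟩)
    EReal.bot_lt_zero h

theorem lt_top_of_sum_lt_top {ι : Type*} {s : Finset ι} {c : ι → EReal} (h : ∀ i ∈ s, ⊥ < c i)
    (hs : ∑ i ∈ s, c i < ⊤) {i : ι} (hi : i ∈ s) : c i < ⊤ := by
  classical
  rw [← Finset.add_sum_erase s c hi] at hs
  exact (lt_top_of_add_lt_top (h i hi)
    (bot_lt_sum fun j hj => h j (Finset.mem_of_mem_erase hj)) hs).1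

/-- An arc of finite cost admits at each time a control attaining the Lagrangian; conversely each
feasible control bounds it above. -/
theorem IsLinearConvex.value_eq_bolzaValue (hP : P.IsLinearConvex)
    (hg : (P.X P.T ∩ dom P.g).Nonempty) (hA : ∀ t < P.T, P.CondA t) {τ : ℕ} (hτ : τ ≤ P.T)
    (ξ : 𝔼 (Fin n)) :
    P.value τ ξ = bolzaValue P.T P.lagrangian P.terminalCost τ ξ := by
  refine le_antisymm (le_iInf₂ fun x hx => ?_)
    (le_iInf₂ fun x u => le_iInf fun hF => ?_)
  · rcases eq_or_ne ((∑ t ∈ Finset.Ico τ P.T, P.lagrangian (t + 1) (x t) (x (t + 1) - x t)) +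
      P.terminalCost (x P.T)) ⊤ with h | h
    · rw [h]; exact le_top
    have hbot : ∀ t ∈ Finset.Ico τ P.T, ⊥ < P.lagrangian (t + 1) (x t) (x (t + 1) - x t) :=
      fun t ht => hP.bot_lt_lagrangian (Finset.mem_Ico.1 ht).2 (hA t (Finset.mem_Ico.1 ht).2) _ _
    obtain ⟨h1, h2⟩ := lt_top_of_add_lt_top (bot_lt_sum hbot)
      ((hP.isProperConvexLsc_terminalCost hg).proper.2 _) (lt_top_iff_ne_top.2 h)
    have hu : ∀ t, ∃ u, t ∈ Finset.Ico τ P.T → (x t, u) ∈ P.Omega t ∧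
        x (t + 1) - x t = P.velocity t (x t) u ∧
          (P.ℓ t (x t) u : EReal) ≤ P.lagrangian (t + 1) (x t) (x (t + 1) - x t) := by
      intro t
      by_cases ht : t ∈ Finset.Ico τ P.T
      · obtain ⟨r, hr⟩ := exists_coe_eq (hbot t ht) (lt_top_of_sum_lt_top hbot h1 ht)
        have htT := (Finset.mem_Ico.1 ht).2
        obtain ⟨u, k1, k2, k3⟩ := (hP.lagrangian_le_coe_iff htT (hA t htT)).1 hr.le
        exact ⟨u, fun _ => ⟨k1, k2, by rw [hr]; exact_mod_cast k3⟩⟩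
      · exact ⟨0, fun h => absurd h ht⟩
    choose u hu using hu
    have hxT : x P.T ∈ P.X P.T ∩ dom P.g := hP.dom_terminalCost ▸ h2
    have hF : P.IsFeasible τ ξ x u :=
      ⟨hx, fun t ht => (hu t ht).2.1, fun t ht => (hu t ht).1.2.2, fun t ht => (hu t ht).1.2.1,
        fun t ht => by
          -- The constraint at the final time comes from the terminal cost, the earlier ones from
          -- Ω_t.
          rcases (Finset.mem_Icc.1 ht).2.eq_or_lt with rfl | hlt
          · exact hxT.1
          · exact (hu t (Finset.mem_Ico.2 ⟨(Finset.mem_Icc.1 ht).1, hlt⟩)).1.1⟩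
    refine (iInf₂_le_of_le x u (iInf_le _ hF)).trans ?_
    rw [coe_finset_sum, hP.terminalCost_apply, if_pos hxT.1]
    exact add_le_add_left (Finset.sum_le_sum fun t ht => (hu t ht).2.2) _
  · refine (iInf₂_le x hF.init).trans ?_
    rw [coe_finset_sum, hP.terminalCost_apply,
      if_pos (hF.state P.T (Finset.mem_Icc.2 ⟨hτ, le_rfl⟩))]
    refine add_le_add_left (Finset.sum_le_sum fun t ht => ?_) _
    have ht' := Finset.mem_Ico.1 ht
    exact (hP.lagrangian_le_coe_iff ht'.2 (hA t ht'.2)).2 ⟨u t,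
      ⟨hF.state t (Finset.mem_Icc.2 ⟨ht'.1, ht'.2.le⟩), hF.control t ht, hF.mixed t ht⟩,
      hF.dyn t ht, le_rfl⟩

/-! ### Strictly feasible processes -/

/-- Strict feasibility persists for small δ by continuity, so only the cores of X_t and U_t restrict
the prolongation. -/
theorem IsLinearConvex.mem_relCore_Omega (hP : P.IsLinearConvex) {t : ℕ} (ht : t < P.T)
    {x : 𝔼 (Fin n)} {u : 𝔼 (Fin m)} (hx : x ∈ relCore (P.X t)) (hu : u ∈ relCore (P.U t))
    (hf : P.f t x u < 0) : (x, u) ∈ relCore (P.Omega t) := by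
  refine ⟨⟨hx.1, hu.1, hf.le⟩, fun ⟨x', u'⟩ hz => ?_⟩
  have hc : Continuous fun δ : ℝ => P.f t (x + δ • (x - x')) (u + δ • (u - u')) :=
    (hP.continuous_mixed ht).comp (by fun_prop :
      Continuous fun δ : ℝ => (x + δ • (x - x'), u + δ • (u - u')))
  have h3 : ∀ᶠ δ in 𝓝 (0 : ℝ), P.f t (x + δ • (x - x')) (u + δ • (u - u')) < 0 :=
    hc.continuousAt.eventually_lt_const (by simpa using hf)
  filter_upwards [hx.2 x' hz.1, hu.2 u' hz.2.1, nhdsWithin_le_nhds h3] with δ k1 k2 k3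
  exact ⟨k1, k2, k3.le⟩

/-- The domain of the Lagrangian is the image of Ω_t under the affine map (x, u) ↦ (x, velocity),
which carries prolonged segments to prolonged segments. -/
theorem IsLinearConvex.mem_relCore_dom_lagrangian (hP : P.IsLinearConvex) {t : ℕ} (ht : t < P.T)
    (hA : P.CondA t) {x : 𝔼 (Fin n)} {u : 𝔼 (Fin m)} (h : (x, u) ∈ relCore (P.Omega t)) :
    (x, P.velocity t x u) ∈
      relCore {q : 𝔼 (Fin n) × 𝔼 (Fin n) | P.lagrangian (t + 1) q.1 q.2 < ⊤} := by
  refine ⟨(hP.lagrangian_lt_top_iff ht hA).2 ⟨u, h.1, rfl⟩, fun ⟨x', v'⟩ hz => ?_⟩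
  obtain ⟨u', h1, h2⟩ := (hP.lagrangian_lt_top_iff ht hA).1 hz
  dsimp only at h1 h2
  filter_upwards [h.2 (x', u') h1] with δ hδ
  refine (hP.lagrangian_lt_top_iff ht hA).2 ⟨u + δ • (u - u'), hδ, ?_⟩
  have e := P.velocity_combo t (x := x) (x' := x') (u := u) (u' := u') (α := 1 + δ) (β := -δ)
    (by ring)
  have e1 : x + δ • (x - x') = (1 + δ) • x + (-δ) • x' := by module
  have e2 : u + δ • (u - u') = (1 + δ) • u + (-δ) • u' := by module
  simp only [Prod.snd_add, Prod.smul_snd, Prod.snd_sub, Prod.fst_add, Prod.smul_fst, Prod.fst_sub]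
  rw [h2, e1, e2, e]
  module

theorem IsLinearConvex.exists_relCore_of_hasSlaterSolution (hP : P.IsLinearConvex)
    (hA : ∀ t < P.T, P.CondA t) {τ : ℕ} (h : P.HasSlaterSolution τ) :
    ∃ x : ℕ → 𝔼 (Fin n), x P.T ∈ relCore (dom P.terminalCost) ∧ ∀ t ∈ Finset.Ico τ P.T,
      (x t, x (t + 1) - x t) ∈
        relCore {q : 𝔼 (Fin n) × 𝔼 (Fin n) | P.lagrangian (t + 1) q.1 q.2 < ⊤} := by
  obtain ⟨x, u, h1, h2⟩ := h
  refine ⟨x, hP.dom_terminalCost ▸ intrinsicInterior_subset_relCore _ h2, fun t ht => ?_⟩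
  obtain ⟨k1, k2, k3, k4⟩ := h1 t ht
  have htT := (Finset.mem_Ico.1 ht).2
  have e : x (t + 1) - x t = P.velocity t (x t) (u t) := by
    have hd : P.drift t = -(Matrix.toEuclideanLin (P.A t + 1) (x t) - x (t + 1) +
        Matrix.toEuclideanLin (P.B t) (u t)) := by rw [k1, neg_neg]
    rw [velocity, hd, map_add, Matrix.toLpLin_one]
    simp only [LinearMap.add_apply, LinearMap.id_apply]
    abel
  rw [e]
  exact hP.mem_relCore_dom_lagrangian htT (hA t htT) (hP.mem_relCore_Omega htT
    (intrinsicInterior_subset_relCore _ k2) (intrinsicInterior_subset_relCore _ k3) k4)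

end Convex

end MixProblem

end BolzaMix

end

/-! ### Value equality, sufficiency and necessity of characteristics -/

theorem mainTheorem6 {n m : ℕ} (P : BolzaMix.MixProblem n m) (hP : P.IsLinearConvex)
    (hΩ : ∀ t < P.T, (P.Omega t).Nonempty) (hg : (P.X P.T ∩ BolzaMix.dom P.g).Nonempty)
    (hA : ∀ t < P.T, P.CondA t) :
    -- the Bolza formulation is proper, convex and lsc, and has the same value
    (∀ t < P.T, BolzaMix.IsProperConvexLsc
      (fun q : EuclideanSpace ℝ (Fin n) × EuclideanSpace ℝ (Fin n) =>
        P.lagrangian (t + 1) q.1 q.2)) ∧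
    BolzaMix.IsProperConvexLsc P.terminalCost ∧
    (∀ τ < P.T, ∀ ξ : EuclideanSpace ℝ (Fin n),
      P.value τ ξ = BolzaMix.bolzaValue P.T P.lagrangian P.terminalCost τ ξ) ∧
    -- sufficiency
    (∀ τ < P.T, ∀ ξ η : EuclideanSpace ℝ (Fin n),
      BolzaMix.HasCharacteristic P.T P.lagrangian P.terminalCost τ ξ η →
      η ∈ BolzaMix.subdiff (BolzaMix.bolzaValue P.T P.lagrangian P.terminalCost τ) ξ) ∧
    -- necessity
    (∀ τ < P.T, P.HasSlaterSolution τ →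
      ((∀ t ∈ Finset.Ico τ P.T,
          (IsCompact (P.U t) ∧ P.RankCond t) ∨ IsCompact (P.X t) ∨ P.CoerciveInState t) ∨
        (∀ t ∈ Finset.Ico τ P.T, P.CoerciveCost t ∨ (P.RankCond t ∧ P.CondB t))) →
      ∀ ξ η : EuclideanSpace ℝ (Fin n),
        η ∈ BolzaMix.subdiff (BolzaMix.bolzaValue P.T P.lagrangian P.terminalCost τ) ξ →
        BolzaMix.HasCharacteristic P.T P.lagrangian P.terminalCost τ ξ η) := by
  have hL : ∀ t < P.T, BolzaMix.IsRegularLagrangian (P.lagrangian (t + 1)) :=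
    fun t ht => hP.isRegularLagrangian ht (hA t ht) (hΩ t ht)
  have hg' := hP.isProperConvexLsc_terminalCost hg
  refine ⟨fun t ht => (hL t ht).pcl, hg', fun τ hτ ξ => hP.value_eq_bolzaValue hg hA hτ.le ξ,
    fun τ hτ ξ η => ?_, fun τ hτ hS _ ξ η hη => ?_⟩
  · rintro ⟨x, p, hH, rfl, hp, hT⟩
    obtain rfl : η = -p τ := by rw [hp, neg_neg]
    exact BolzaMix.mem_subdiff_bolzaValue_of_trajectory hL hg' hT hτ.le hH
  · obtain ⟨x, hxT, hx⟩ := hP.exists_relCore_of_hasSlaterSolution hA hS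
    exact BolzaMix.hasCharacteristic_of_mem_subdiff hL hg' hxT hτ.le hx hη
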